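/- Let $d\ge 1$ be an integer. There is a continuous curve $\alpha:[0,1]\to[0,1]^d$ with the following properties. (Hilbert type.) For every integer $n\ge 0$, the images under $\alpha$ of the $2^{nd}$ intervals $\left[\frac{k}{2^{nd}},\frac{k+1}{2^{nd}}\right]$, $0\le k<2^{nd}$, are exactly the $2^{nd}$ cubes $\prod_{i=1}^d\left[\frac{k_i}{2^n},\frac{k_i+1}{2^n}\right]$, $0\le k_i<2^n$: each of these intervals is mapped onto one of these cubes, and each of these cubes is the image of one of these intervals. For every subset $F\subseteq[0,1]^d$ the following two statements hold. (i) If the box dimension of $F$ exists, then the box dimension of $\alpha^{-1}(F)\subseteq[0,1]$ also exists, and $\dim_B(F)=d\cdot\dim_B(\alpha^{-1}(F))$. (ii) $\dim_H(F)=d\cdot\dim_H(\alpha^{-1}(F))$. Here $\dim_H$ is Hausdorff dimension. The box dimension of a bounded set $E\subseteq\mathbb R^m$ is the limit $\dim_B(E)=\lim_{\delta\to0^+}\frac{\log N_\delta(E)}{-\log\delta}$, if it exists, where $N_\delta(E)$ is the number of cubes $\prod_{i=1}^m[k_i\delta,(k_i+1)\delta]$, $k_i\in\mathbb Z$, that intersect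 $E$; the empty set has box dimension $0$. -/

import Mathlib

open Set Filter Topology
open scoped ENNReal

noncomputable section

/-- The closed unit cube `[0,1]^d` in Euclidean space `ℝ^d`. -/
def unitCube (d : ℕ) : Set (EuclideanSpace ℝ (Fin d)) :=
  {x | ∀ i, x i ∈ Icc (0 : ℝ) 1}

/-- The closed grid `δ`-cube `[k₁δ, (1+k₁)δ] × ⋯ × [k_dδ, (1+k_d)δ]` with index `k ∈ ℤ^d`. -/
def gridCube {d : ℕ} (δ : ℝ) (k : Fin d → ℤ) : Set (EuclideanSpace ℝ (Fin d)) :=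
  {x | ∀ i, x i ∈ Icc ((k i : ℝ) * δ) ((1 + (k i : ℝ)) * δ)}

/-- The number of grid `δ`-cubes of `ℝ^d` that intersect `F`
(finite whenever `F` is bounded and `0 < δ`). -/
def boxCount {d : ℕ} (F : Set (EuclideanSpace ℝ (Fin d))) (δ : ℝ) : ℕ :=
  {k : Fin d → ℤ | (gridCube δ k ∩ F).Nonempty}.ncard

/-- The box dimension of the bounded set `F ⊆ ℝ^d` exists and equals `s`: the quotient
`log N_δ(F) / (-log δ)` tends to `s` as `δ → 0⁺`, where `N_δ(F)` is the number of grid `δ`-cubes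
that intersect `F`. (The empty set gets dimension `0`.) -/
def HasBoxDim {d : ℕ} (F : Set (EuclideanSpace ℝ (Fin d))) (s : ℝ) : Prop :=
  Tendsto (fun δ : ℝ => Real.log (boxCount F δ) / -Real.log δ) (𝓝[>] 0) (𝓝 s)

/-- The standard identification of `ℝ` with `ℝ^1`. -/
def toLine (t : ℝ) : EuclideanSpace ℝ (Fin 1) := !₂[t]

/-- Level `n` of the fractal structure on `[0,1]`: the `2^(nd)` closed intervals
`[k / 2^(nd), (1+k) / 2^(nd)]`, `k = 0, …, 2^(nd) - 1`. -/
def intervalLevel (d n : ℕ) : Set (Set (Icc (0 : ℝ) 1)) :=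
  {A | ∃ k : ℕ, k < 2 ^ (n * d) ∧
    A = {t | (t : ℝ) ∈ Icc ((k : ℝ) / 2 ^ (n * d)) ((1 + (k : ℝ)) / 2 ^ (n * d))}}

/-- Level `n` of the natural fractal structure on `[0,1]^d`: the `2^(nd)` closed cubes
`∏ i, [k_i / 2^n, (1+k_i) / 2^n]`, `k_i = 0, …, 2^n - 1`. -/
def cubeLevel (d n : ℕ) : Set (Set (EuclideanSpace ℝ (Fin d))) :=
  {Q | ∃ k : Fin d → ℕ, (∀ i, k i < 2 ^ n) ∧
    Q = {x | ∀ i, x i ∈ Icc ((k i : ℝ) / 2 ^ n) ((1 + (k i : ℝ)) / 2 ^ n)}}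

/-- The preimage `α⁻¹(F)`, as a subset of the real line. -/
def curvePreimage {d : ℕ} (α : Icc (0 : ℝ) 1 → EuclideanSpace ℝ (Fin d))
    (F : Set (EuclideanSpace ℝ (Fin d))) : Set ℝ :=
  Subtype.val '' (α ⁻¹' F)

end

/-!
The curve is a `d`-dimensional Hilbert curve. A cube is subdivided into `2^d` halved subcubes, which
are passed through in the order of the reflected Gray code, each of them from one corner to a
neighbouring corner along an edge. Such a path exists for every entry corner `e` of the big cube and
every neighbouring exit corner (`exists_full_passages`): a path through the subcubes of a face is
run through, and then its mirror image is run backwards; the last edge of the first half and the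
first edge of the second half form the step across. Using these paths at all levels numbers the
dyadic cubes of level `n` by `k < 2^(nd)` so that parents of cubes correspond to parents of
intervals and consecutive cubes share a lattice point (`DyadicOrder`, `exists_dyadicOrder`). The
limit `DyadicOrder.curve` of the nested cubes therefore maps each dyadic interval of length `2^{-nd}`
onto the dyadic cube of side `2^{-n}` with the same number (`DyadicOrder.curveOn_image_interval`),
and two parameters at distance at most `2^{-nd}` lie in intervals whose cubes touch, so the curve is
Hölder continuous with exponent `1/d` (`DyadicOrder.holderWith_curveOn`).

Intervals and cubes correspond bijectively at each level, so the number of intervals of length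
`2^{-nd}` that meet the preimage of `F` and the number of cubes of side `2^{-n}` that meet `F` agree
up to a constant factor, which accounts for neighbouring cubes. Changing the scale by a bounded
factor costs another constant, so the counts at scales `η^d` and `η` are comparable for all
`η ∈ (0,1]` (`DyadicOrder.exists_boxCount_comparison`), and a constant disappears in the quotient of
logarithms.

For the Hausdorff dimension, Hölder continuity gives `dimH F ≤ d * dimH (α⁻¹ F)`. Conversely, a set
of diameter at most `2^{-n}` meets at most `4^d` of the dyadic cubes of level `n`, so its preimage
is covered by `4^d` intervals of length `2^{-nd}` (`DyadicOrder.exists_cover_preimage`). Coverings of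
`F` thus pull back to coverings of `α⁻¹ F`, with `s`-dimensional sums for `F` controlling
`s/d`-dimensional sums for `α⁻¹ F` (`mul_dimH_preimage_le`).
-/

/-! ### Paths through the subcubes of a cube -/

/-- The corner `a` of the unit cube with its `j`-th coordinate flipped. -/
def flipAt {d : ℕ} (j : Fin d) (a : Fin d → Bool) : Fin d → Bool :=
  fun i => if i = j then !a i else a i

theorem flipAt_flipAt {d : ℕ} (j : Fin d) (a : Fin d → Bool) : flipAt j (flipAt j a) = a := by
  funext i
  simp only [flipAt]
  split_ifs <;> simp

theorem flipAt_comm {d : ℕ} (j k : Fin d) (a : Fin d → Bool) :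
    flipAt j (flipAt k a) = flipAt k (flipAt j a) := by
  funext i
  simp only [flipAt]
  split_ifs <;> rfl

/-- A passage through one of the `2^d` halved subcubes of a cube, along one of its edges. -/
structure Passage (d : ℕ) where
  /-- The subcube, named by the corner of the big cube that it contains. -/
  sub : Fin d → Bool
  /-- The corner of the subcube, in its own coordinates, at which it is entered. -/
  corner : Fin d → Bool
  /-- The direction of the edge along which the subcube is left. -/
  dir : Fin d

namespace Passage

variable {d : ℕ}

/-- The point of entry, in coordinates where the big cube has side `2`. -/
def source (x : Passage d) : Fin d → ℕ := fun i => (x.sub i).toNat + (x.corner i).toNat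

/-- The point of exit, in coordinates where the big cube has side `2`. -/
def target (x : Passage d) : Fin d → ℕ :=
  fun i => (x.sub i).toNat + (flipAt x.dir x.corner i).toNat

/-- The passage reflected in the `j`-th coordinate and run backwards. -/
def mirror (j : Fin d) (x : Passage d) : Passage d :=
  ⟨flipAt j x.sub, flipAt j (flipAt x.dir x.corner), x.dir⟩

theorem target_mirror_eq_source_mirror (j : Fin d) {x y : Passage d} (h : x.target = y.source) :
    (y.mirror j).target = (x.mirror j).source := by
  funext i
  have hi := congrFun h i
  simp only [source, target, mirror] at hi ⊢
  rw [flipAt_comm, flipAt_flipAt]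
  generalize flipAt x.dir x.corner = a at hi ⊢
  by_cases hij : i = j
  · cases h1 : x.sub i <;> cases h2 : y.sub i <;> cases h3 : a i <;> cases h4 : y.corner i <;>
      simp only [flipAt, if_pos hij, h1, h2, h3, h4] at hi ⊢ <;> simp at hi ⊢
  · simpa [flipAt, hij] using hi.symm

theorem target_eq_source_mirror {x : Passage d} (h : x.sub x.dir = x.corner x.dir) :
    x.target = (x.mirror x.dir).source := by
  funext i
  simp only [source, target, mirror, flipAt]
  by_cases h1 : i = x.dir
  · subst h1
    cases h2 : x.sub x.dir <;> simp_all
  · simp [h1]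

/-- Two passages can be run one after the other. -/
def Link (x y : Passage d) : Prop := x.target = y.source

end Passage

section Paths

open Passage

/-- The fold of a path: run through it, then through its mirror image backwards. -/
theorem isChain_append_mirror {d : ℕ} {M : List (Passage d)} {w a : Fin d → Bool} {j : Fin d}
    (hM : (M ++ [Passage.mk w a j]).IsChain Link) (hwa : w j = a j) :
    ((M ++ [Passage.mk w a j]) ++ ((M ++ [Passage.mk w a j]).map (mirror j)).reverse).IsChain Link := by
  refine List.isChain_append.2 ⟨hM, ?_, ?_⟩
  · rw [List.isChain_reverse, List.isChain_map]
    exact hM.imp fun x y h => target_mirror_eq_source_mirror j h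
  · intro x hx y hy
    simp only [List.getLast?_append, List.getLast?_singleton, Option.some_or, Option.mem_def,
      Option.some.injEq, List.map_append, List.map_cons, List.map_nil, List.reverse_append,
      List.reverse_cons, List.reverse_nil, List.nil_append, List.cons_append,
      List.head?_cons] at hx hy
    subst hx hy
    exact target_eq_source_mirror (x := ⟨w, a, j⟩) hwa

/-- The passages, in order, of the reflected Gray code on the coordinates in `S`, with the corners
at which the subcubes are entered. The direction in which the last subcube is left stays free, and
this is what lets the induction over `S` fold the path over in a new direction. -/
theorem exists_passages {d : ℕ} (e : Fin d → Bool) (S : Finset (Fin d)) :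
    ∃ (M : List (Passage d)) (w a : Fin d → Bool),
      (∀ x ∈ M, x.dir ∈ S) ∧ (∀ i ∉ S, w i = a i) ∧ M.length + 1 = 2 ^ S.card ∧
      ∀ j, (M ++ [Passage.mk w a j]).IsChain Link ∧
        (∃ x : Passage d, (M ++ [Passage.mk w a j]).head? = some x ∧ x.sub = e ∧ x.corner = e) ∧
        ∀ u : Fin d → Bool, (∀ i ∉ S, u i = e i) → ∃ x ∈ M ++ [Passage.mk w a j], x.sub = u := by
  induction S using Finset.induction_on with
  | empty =>
    refine ⟨[], e, e, by simp, by simp, by simp, fun j => ⟨by simp, by simp, fun u hu => ?_⟩⟩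
    exact ⟨⟨e, e, j⟩, by simp, by funext i; simp [hu i]⟩
  | insert j S hj ih =>
    obtain ⟨M, w, a, hdir, hwa, hlen, h⟩ := ih
    obtain ⟨hchain, ⟨f, hf, hfs, hfc⟩, hall⟩ := h j
    have hfold := isChain_append_mirror hchain (hwa j hj)
    generalize hL : M ++ [Passage.mk w a j] = L at *
    have hdirL : ∀ x ∈ L, x.dir ∈ insert j S := by
      intro x hx
      simp only [← hL, List.mem_append, List.mem_singleton] at hx
      rcases hx with hx | rfl
      · exact Finset.mem_insert_of_mem (hdir x hx)
      · exact Finset.mem_insert_self _ _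
    obtain ⟨T, rfl⟩ : ∃ T, L = f :: T := by
      cases L with
      | nil => simp at hf
      | cons b T => exact ⟨T, by simpa using hf⟩
    have hfold' : (f :: T) ++ (((f :: T).map (mirror j)).reverse) =
        ((f :: T) ++ (T.map (mirror j)).reverse) ++ [f.mirror j] := by simp
    rw [hfold'] at hfold
    refine ⟨(f :: T) ++ (T.map (mirror j)).reverse, (f.mirror j).sub, (f.mirror j).corner,
      ?_, ?_, ?_, fun k => ⟨?_, ⟨f, by simp, hfs, hfc⟩, ?_⟩⟩
    · intro x hx
      simp only [List.mem_append, List.mem_reverse, List.mem_map] at hx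
      rcases hx with hx | ⟨y, hy, rfl⟩
      · exact hdirL x hx
      · exact hdirL y (List.mem_cons_of_mem _ hy)
    · intro i hi
      have h1 : i ≠ j := fun h => hi (h ▸ Finset.mem_insert_self _ _)
      have h2 : i ≠ f.dir := fun h => hi (h ▸ hdirL f (by simp))
      simp [mirror, flipAt, h1, h2, hfs, hfc]
    · have h1 : (f :: T).length = M.length + 1 := by rw [← hL]; simp
      rw [Finset.card_insert_of_notMem hj, pow_succ, ← hlen]
      simp only [List.length_append, List.length_reverse, List.length_map, List.length_cons]
        at h1 ⊢
      omega
    · rw [List.isChain_append] at hfold ⊢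
      refine ⟨hfold.1, by simp, fun x hx y hy => ?_⟩
      have := hfold.2.2 x hx (f.mirror j) (by simp)
      simp only [List.head?_cons, Option.mem_def, Option.some.injEq] at hy
      subst hy
      exact this
    · intro u hu
      have key : ∃ x ∈ (f :: T) ++ (((f :: T).map (mirror j)).reverse), x.sub = u := by
        by_cases huj : u j = e j
        · obtain ⟨x, hx, hxu⟩ := hall u fun i hi => by
            by_cases hij : i = j
            · rw [hij, huj]
            · exact hu i (by simp [hij, hi])
          exact ⟨x, List.mem_append_left _ hx, hxu⟩
        · obtain ⟨x, hx, hxu⟩ := hall (flipAt j u) fun i hi => by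
            by_cases hij : i = j
            · subst hij
              cases h1 : u i <;> cases h2 : e i <;> simp_all [flipAt]
            · simpa [flipAt, hij] using hu i (by simp [hij, hi])
          refine ⟨x.mirror j, List.mem_append_right _ ?_, by simp [mirror, hxu, flipAt_flipAt]⟩
          simp only [List.mem_reverse, List.mem_map]
          exact ⟨x, hx, rfl⟩
      rw [hfold'] at key
      obtain ⟨x, hx, hxu⟩ := key
      rw [List.mem_append, List.mem_singleton] at hx
      rcases hx with hx | rfl
      · exact ⟨x, List.mem_append_left _ hx, hxu⟩
      · exact ⟨_, List.mem_append_right _ (List.mem_singleton_self _), hxu⟩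

/-- A path through all `2^d` subcubes from the corner `e` of the cube to the neighbouring corner
in direction `j`. -/
theorem exists_full_passages {d : ℕ} (e : Fin d → Bool) (j : Fin d) :
    ∃ L : List (Passage d), L.length = 2 ^ d ∧ L.IsChain Link ∧
      (∃ x : Passage d, L.head? = some x ∧ x.sub = e ∧ x.corner = e) ∧
      (∃ x : Passage d, L.getLast? = some x ∧ x.sub = flipAt j e ∧
        flipAt x.dir x.corner = flipAt j e) ∧
      ∀ u : Fin d → Bool, ∃ x ∈ L, x.sub = u := by
  obtain ⟨M, w, a, -, hwa, hlen, h⟩ := exists_passages e (Finset.univ.erase j)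
  obtain ⟨hchain, ⟨f, hf, hfs, hfc⟩, hall⟩ := h j
  have hd : 2 ^ d = (M.length + 1) * 2 := by
    rw [hlen, ← pow_succ, Finset.card_erase_add_one (Finset.mem_univ j), Finset.card_univ,
      Fintype.card_fin]
  refine ⟨_, ?_, isChain_append_mirror hchain (hwa j (by simp)), ⟨f, ?_, hfs, hfc⟩,
    ⟨f.mirror j, ?_, ?_, ?_⟩, fun u => ?_⟩
  · simp only [List.length_append, List.length_reverse, List.length_map, List.length_cons,
      List.length_nil]
    omega
  · rw [List.head?_append, hf]
    rfl
  · simp only [List.getLast?_append, List.getLast?_reverse, List.head?_map, hf]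
    simp
  · simp [mirror, hfs]
  · simp only [mirror]
    rw [flipAt_comm, flipAt_flipAt, hfc]
  · by_cases huj : u j = e j
    · obtain ⟨x, hx, hxu⟩ := hall u fun i hi => by
        have : i = j := by simpa using hi
        rw [this, huj]
      exact ⟨x, List.mem_append_left _ hx, hxu⟩
    · obtain ⟨x, hx, hxu⟩ := hall (flipAt j u) fun i hi => by
        have : i = j := by simpa using hi
        subst this
        cases h1 : u i <;> cases h2 : e i <;> simp_all [flipAt]
      refine ⟨x.mirror j, List.mem_append_right _ ?_, by simp [mirror, hxu, flipAt_flipAt]⟩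
      simp only [List.mem_reverse, List.mem_map]
      exact ⟨x, hx, rfl⟩

/-- The list of `exists_full_passages` as a function of the position, for all corners and all
directions. -/
theorem exists_passage_table (d : ℕ) :
    ∃ T : (Fin d → Bool) → Fin d → ℕ → Passage d, ∀ e j,
      ((T e j 0).sub = e ∧ (T e j 0).corner = e) ∧
      ((T e j (2 ^ d - 1)).sub = flipAt j e ∧
        flipAt (T e j (2 ^ d - 1)).dir (T e j (2 ^ d - 1)).corner = flipAt j e) ∧
      (∀ i, i + 1 < 2 ^ d → (T e j i).target = (T e j (i + 1)).source) ∧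
      ∀ u : Fin d → Bool, ∃ i < 2 ^ d, (T e j i).sub = u := by
  choose L hlen hchain hhead hlast hall using @exists_full_passages d
  refine ⟨fun e j i => (L e j).getD i ⟨e, e, j⟩, fun e j => ⟨?_, ?_, fun i hi => ?_, fun u => ?_⟩⟩
  · obtain ⟨x, hx, h1⟩ := hhead e j
    rw [List.head?_eq_getElem?] at hx
    simpa [List.getD_eq_getElem?_getD, hx] using h1
  · obtain ⟨x, hx, h1⟩ := hlast e j
    rw [List.getLast?_eq_getElem?, hlen] at hx
    simpa [List.getD_eq_getElem?_getD, hx] using h1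
  · have h := List.isChain_iff_getElem.1 (hchain e j) i (by rw [hlen]; exact hi)
    simp only
    rw [List.getD_eq_getElem _ _ (by rw [hlen]; omega),
      List.getD_eq_getElem _ _ (by rw [hlen]; omega)]
    exact h
  · obtain ⟨x, hx, hxu⟩ := hall e j u
    obtain ⟨i, hi, rfl⟩ := List.getElem_of_mem hx
    refine ⟨i, by rwa [hlen] at hi, ?_⟩
    simp only
    rw [List.getD_eq_getElem _ _ hi, hxu]

end Paths

/-! ### Numbering of the dyadic cubes -/

/-- A coherent numbering of the dyadic subcubes of `[0,1]^d` at all levels: the number `k / 2^d`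
belongs to the parent of the cube with number `k`, and consecutive cubes share a lattice point that
stays the same, after rescaling, at the next level. Cubes and lattice points of level `n` are given
by their coordinates in units of `2^{-n}`. -/
structure DyadicOrder (d : ℕ) where
  /-- The lower corner of the `k`-th cube of level `n`. -/
  cell : ℕ → ℕ → Fin d → ℕ
  /-- The lattice point at which the `k`-th cube of level `n` is entered. -/
  entry : ℕ → ℕ → Fin d → ℕ
  cell_zero : ∀ k i, cell 0 k i = 0
  cell_succ_div : ∀ n k i, cell (n + 1) k i / 2 = cell n (k / 2 ^ d) i
  exists_child : ∀ n k (u : Fin d → Bool),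
    ∃ l, l / 2 ^ d = k ∧ ∀ i, cell (n + 1) l i = 2 * cell n k i + (u i).toNat
  entry_mem : ∀ n k i, entry n k i ∈ Icc (cell n k i) (cell n k i + 1)
  entry_succ_mem : ∀ n k, k + 1 < 2 ^ (n * d) →
    ∀ i, entry n (k + 1) i ∈ Icc (cell n k i) (cell n k i + 1)
  entry_succ_mul : ∀ n k i, entry (n + 1) (k * 2 ^ d) i = 2 * entry n k i

section Construction

open Passage

variable {d : ℕ} (T : (Fin d → Bool) → Fin d → ℕ → Passage d) (j₀ : Fin d)

/-- The `k`-th cube of level `n`, with the corner at which it is entered and the direction of the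
edge joining that corner to the exit, when cubes are subdivided by the table `T`. -/
def cellState : ℕ → ℕ → (Fin d → ℕ) × (Fin d → Bool) × Fin d
  | 0, _ => (fun _ => 0, fun _ => false, j₀)
  | n + 1, k =>
    let s := cellState n (k / 2 ^ d)
    let x := T s.2.1 s.2.2 (k % 2 ^ d)
    (fun i => 2 * s.1 i + (x.sub i).toNat, x.corner, x.dir)

/-- Consecutive cubes of a level are joined: the exit of one is the entry of the next. The first and
last passages of the table keep the entry and exit of the subdivided cube, so this property is
inherited from level to level. -/
theorem cellState_exit_eq_entry
    (hhead : ∀ e j, (T e j 0).sub = e ∧ (T e j 0).corner = e)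
    (hlast : ∀ e j, (T e j (2 ^ d - 1)).sub = flipAt j e ∧
        flipAt (T e j (2 ^ d - 1)).dir (T e j (2 ^ d - 1)).corner = flipAt j e)
    (hlink : ∀ e j, ∀ i, i + 1 < 2 ^ d → (T e j i).target = (T e j (i + 1)).source)
    (n k : ℕ) (hk : k + 1 < 2 ^ (n * d)) (i : Fin d) :
    (cellState T j₀ n k).1 i +
        (flipAt (cellState T j₀ n k).2.2 (cellState T j₀ n k).2.1 i).toNat =
      (cellState T j₀ n (k + 1)).1 i + ((cellState T j₀ n (k + 1)).2.1 i).toNat := by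
  induction n generalizing k with
  | zero => simp at hk
  | succ n ih =>
    have hpos : 0 < 2 ^ d := by positivity
    have hk' : k + 1 < 2 ^ (n * d) * 2 ^ d := by rwa [← pow_add, ← Nat.succ_mul]
    have hdm := Nat.div_add_mod k (2 ^ d)
    have hlt := Nat.mod_lt k hpos
    simp only [cellState]
    set q := k / 2 ^ d with hq
    set r := k % 2 ^ d with hr
    by_cases h : r + 1 < 2 ^ d
    · -- the two cubes have the same parent
      have h1 : (k + 1) / 2 ^ d = q := by
        rw [← hdm, add_assoc, Nat.mul_add_div hpos, Nat.div_eq_of_lt h, add_zero]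
      have h2 : (k + 1) % 2 ^ d = r + 1 := by
        rw [← hdm, add_assoc, Nat.mul_add_mod, Nat.mod_eq_of_lt h]
      rw [h1, h2]
      have := congrFun (hlink (cellState T j₀ n q).2.1 (cellState T j₀ n q).2.2 r h) i
      simp only [source, target] at this
      omega
    · -- the last child of one cube is followed by the first child of the next
      have hr1 : r = 2 ^ d - 1 := by omega
      have hk1 : k + 1 = (q + 1) * 2 ^ d := by
        rw [add_mul, mul_comm q]
        omega
      have h1 : (k + 1) / 2 ^ d = q + 1 := by rw [hk1, Nat.mul_div_cancel _ hpos]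
      have h2 : (k + 1) % 2 ^ d = 0 := by rw [hk1, Nat.mul_mod_left]
      rw [h1, h2, hr1]
      have hq1 : q + 1 < 2 ^ (n * d) := by
        rw [hk1] at hk'
        exact lt_of_mul_lt_mul_right hk' hpos.le
      have := ih q hq1
      obtain ⟨a1, a2⟩ := hlast (cellState T j₀ n q).2.1 (cellState T j₀ n q).2.2
      obtain ⟨b1, b2⟩ := hhead (cellState T j₀ n (q + 1)).2.1 (cellState T j₀ n (q + 1)).2.2
      rw [a2, a1, b1, b2]
      omega

end Construction

theorem exists_dyadicOrder (d : ℕ) (hd : 1 ≤ d) : Nonempty (DyadicOrder d) := by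
  obtain ⟨T, hT⟩ := exists_passage_table d
  have hpos : 0 < 2 ^ d := by positivity
  let s := cellState T ⟨0, hd⟩
  have hexit := cellState_exit_eq_entry T ⟨0, hd⟩ (fun e j => (hT e j).1)
    (fun e j => (hT e j).2.1) (fun e j => (hT e j).2.2.1)
  refine ⟨⟨fun n k => (s n k).1, fun n k i => (s n k).1 i + ((s n k).2.1 i).toNat,
    fun _ _ => rfl, fun n k i => ?_, fun n k u => ?_, fun n k i => ?_, fun n k hk i => ?_,
    fun n k i => ?_⟩⟩
  · have := Bool.toNat_le ((T (s n (k / 2 ^ d)).2.1 (s n (k / 2 ^ d)).2.2 (k % 2 ^ d)).sub i)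
    simp only [s, cellState] at this ⊢
    omega
  · obtain ⟨r, hr, hru⟩ := (hT (s n k).2.1 (s n k).2.2).2.2.2 u
    have h1 : (2 ^ d * k + r) / 2 ^ d = k := by
      rw [Nat.mul_add_div hpos, Nat.div_eq_of_lt hr, add_zero]
    have h2 : (2 ^ d * k + r) % 2 ^ d = r := by rw [Nat.mul_add_mod, Nat.mod_eq_of_lt hr]
    refine ⟨2 ^ d * k + r, h1, fun i => ?_⟩
    simp only [s, cellState] at hru ⊢
    rw [h1, h2, hru]
  · have := Bool.toNat_le ((s n k).2.1 i)
    simp only [mem_Icc]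
    omega
  · have := hexit n k hk i
    have := Bool.toNat_le (flipAt (s n k).2.2 (s n k).2.1 i)
    simp only [mem_Icc, s] at this ⊢
    omega
  · simp only [s, cellState]
    rw [Nat.mul_div_cancel _ hpos, Nat.mul_mod_left]
    obtain ⟨h1, h2⟩ := (hT (s n k).2.1 (s n k).2.2).1
    simp only [s] at h1 h2
    rw [h1, h2]
    ring

/-! ### Dyadic intervals -/

/-- The number `k` of the half-open interval `[k / 2^(nd), (k+1) / 2^(nd))` that contains `t`; the
endpoint `t = 1` is given to the last interval. -/
noncomputable def dyadicIndex (d n : ℕ) (t : ℝ) : ℕ := min ⌊t * 2 ^ (n * d)⌋₊ (2 ^ (n * d) - 1)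

theorem dyadicIndex_lt (d n : ℕ) (t : ℝ) : dyadicIndex d n t < 2 ^ (n * d) :=
  lt_of_le_of_lt (min_le_right _ _) (Nat.sub_lt (by positivity) one_pos)

theorem dyadicIndex_eq {d n k : ℕ} {t : ℝ} (hk : k < 2 ^ (n * d))
    (h1 : (k : ℝ) / 2 ^ (n * d) ≤ t) (h2 : t < (1 + k) / 2 ^ (n * d)) :
    dyadicIndex d n t = k := by
  have hN : (0 : ℝ) < 2 ^ (n * d) := by positivity
  rw [div_le_iff₀ hN] at h1
  rw [lt_div_iff₀ hN] at h2
  have : ⌊t * 2 ^ (n * d)⌋₊ = k := by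
    rw [Nat.floor_eq_iff ((Nat.cast_nonneg k).trans h1)]
    exact ⟨h1, by linarith⟩
  rw [dyadicIndex, this]
  exact min_eq_left (by omega)

theorem dyadicIndex_one (d n : ℕ) : dyadicIndex d n 1 = 2 ^ (n * d) - 1 := by
  rw [dyadicIndex, one_mul]
  refine min_eq_right ?_
  have : ((2 : ℝ) ^ (n * d)) = ((2 ^ (n * d) : ℕ) : ℝ) := by push_cast; rfl
  rw [this, Nat.floor_natCast]
  exact Nat.sub_le _ _

theorem mem_dyadicIndex (d n : ℕ) {t : ℝ} (ht : t ∈ Icc (0 : ℝ) 1) :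
    t ∈ Icc ((dyadicIndex d n t : ℝ) / 2 ^ (n * d)) ((1 + dyadicIndex d n t) / 2 ^ (n * d)) := by
  have hN : (0 : ℝ) < 2 ^ (n * d) := by positivity
  have hN1 : 1 ≤ 2 ^ (n * d) := Nat.one_le_two_pow
  rw [mem_Icc, div_le_iff₀ hN, le_div_iff₀ hN]
  rcases ht.2.eq_or_lt with rfl | ht1
  · rw [dyadicIndex_one]
    push_cast [Nat.cast_sub hN1]
    constructor <;> linarith
  · have hlt : ⌊t * 2 ^ (n * d)⌋₊ < 2 ^ (n * d) := by
      rw [Nat.floor_lt (mul_nonneg ht.1 hN.le)]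
      push_cast
      nlinarith
    rw [dyadicIndex, min_eq_left (by omega)]
    refine ⟨Nat.floor_le (mul_nonneg ht.1 hN.le), ?_⟩
    have := Nat.lt_floor_add_one (t * 2 ^ (n * d))
    linarith

theorem dyadicIndex_succ_div (d n : ℕ) (t : ℝ) :
    dyadicIndex d (n + 1) t / 2 ^ d = dyadicIndex d n t := by
  have hpos : 0 < 2 ^ d := by positivity
  have hmono : Monotone fun a : ℕ => a / 2 ^ d := fun a b h => Nat.div_le_div_right h
  have h1 : ⌊t * 2 ^ ((n + 1) * d)⌋₊ / 2 ^ d = ⌊t * 2 ^ (n * d)⌋₊ := by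
    rw [← Nat.floor_div_natCast]
    congr 1
    push_cast
    rw [Nat.succ_mul, pow_add]
    field_simp
  have h2 : (2 ^ ((n + 1) * d) - 1) / 2 ^ d = 2 ^ (n * d) - 1 := by
    rw [Nat.succ_mul, pow_add]
    have hN1 : 1 ≤ 2 ^ (n * d) := Nat.one_le_two_pow
    obtain ⟨m, hm⟩ := Nat.exists_eq_add_of_le' hN1
    rw [hm, Nat.add_sub_cancel, Nat.div_eq_iff hpos, add_mul]
    omega
  have := hmono.map_min (a := ⌊t * 2 ^ ((n + 1) * d)⌋₊) (b := 2 ^ ((n + 1) * d) - 1)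
  rw [dyadicIndex, this, h1, h2, dyadicIndex]

theorem eq_of_forall_abs_sub_le_div_two_pow {x y C : ℝ} (h : ∀ j : ℕ, |x - y| ≤ C / 2 ^ j) :
    x = y := by
  have h0 : Tendsto (fun j : ℕ => C / 2 ^ j) atTop (𝓝 0) :=
    tendsto_const_nhds.div_atTop (tendsto_pow_atTop_atTop_of_one_lt one_lt_two)
  have := ge_of_tendsto' h0 h
  exact sub_eq_zero.1 (abs_nonpos_iff.1 this)

theorem EuclideanSpace.dist_le_of_forall_abs_sub_le {d : ℕ} {x y : EuclideanSpace ℝ (Fin d)}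
    {r : ℝ} (hr : 0 ≤ r) (h : ∀ i, |x i - y i| ≤ r) : dist x y ≤ d * r := by
  rw [EuclideanSpace.dist_eq]
  refine Real.sqrt_le_iff.2 ⟨by positivity, ?_⟩
  calc ∑ i, dist (x i) (y i) ^ 2 ≤ ∑ _i : Fin d, r ^ 2 :=
        Finset.sum_le_sum fun i _ => by
          rw [Real.dist_eq]
          exact pow_le_pow_left₀ (abs_nonneg _) (h i) 2
    _ = d * r ^ 2 := by simp
    _ ≤ (d * r) ^ 2 := by
        rw [mul_pow]
        refine mul_le_mul_of_nonneg_right ?_ (sq_nonneg r)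
        exact_mod_cast Nat.le_self_pow two_ne_zero d

/-! ### The curve of a numbering -/

namespace DyadicOrder

variable {d : ℕ} (H : DyadicOrder d)

/-- The `k`-th closed dyadic cube of level `n`. -/
def cube (n k : ℕ) : Set (EuclideanSpace ℝ (Fin d)) :=
  {x | ∀ i, x i ∈ Icc ((H.cell n k i : ℝ) / 2 ^ n) ((1 + (H.cell n k i : ℝ)) / 2 ^ n)}

theorem cell_lt {n k : ℕ} (hk : k < 2 ^ (n * d)) (i : Fin d) : H.cell n k i < 2 ^ n := by
  induction n generalizing k with
  | zero => simp [H.cell_zero]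
  | succ n ih =>
    have h : k / 2 ^ d < 2 ^ (n * d) := by
      rw [Nat.div_lt_iff_lt_mul (by positivity), ← pow_add, ← Nat.succ_mul]
      exact hk
    have h1 := ih h
    have h2 := H.cell_succ_div n k i
    rw [pow_succ]
    omega

theorem exists_cell_eq {n : ℕ} (c : Fin d → ℕ) (hc : ∀ i, c i < 2 ^ n) :
    ∃ k < 2 ^ (n * d), H.cell n k = c := by
  induction n generalizing c with
  | zero =>
    refine ⟨0, by positivity, funext fun i => ?_⟩
    have := hc i
    rw [H.cell_zero]
    simp_all
  | succ n ih =>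
    obtain ⟨k, hk, hkc⟩ := ih (fun i => c i / 2) fun i => by
      have := hc i
      rw [pow_succ] at this
      omega
    obtain ⟨l, hl, hlu⟩ := H.exists_child n k fun i => decide (c i % 2 = 1)
    refine ⟨l, ?_, funext fun i => ?_⟩
    · rw [Nat.succ_mul, pow_add, ← Nat.div_lt_iff_lt_mul (by positivity), hl]
      exact hk
    · rw [hlu, hkc]
      rcases Nat.mod_two_eq_zero_or_one (c i) with h | h <;> simp [h] <;> omega

/-- The map from numbers to cubes is onto by `exists_cell_eq`, so it is injective because there are
as many numbers as cubes. -/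
theorem cell_injOn (n : ℕ) : InjOn (H.cell n) (Iio (2 ^ (n * d))) := by
  have hsub : Fintype.piFinset (fun _ : Fin d => Finset.range (2 ^ n)) ⊆
      (Finset.range (2 ^ (n * d))).image (H.cell n) := by
    intro c hc
    obtain ⟨k, hk, hkc⟩ := H.exists_cell_eq c fun i => by simpa using Fintype.mem_piFinset.1 hc i
    exact Finset.mem_image.2 ⟨k, Finset.mem_range.2 hk, hkc⟩
  have hcard := Finset.card_le_card hsub
  have : InjOn (H.cell n) (Finset.range (2 ^ (n * d)) : Set ℕ) := by
    apply Finset.injOn_of_card_image_eq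
    refine le_antisymm Finset.card_image_le (le_trans (le_of_eq ?_) hcard)
    simp [Fintype.card_piFinset, pow_mul]
  simpa using this

theorem abs_sub_le_of_mem_cube {n k : ℕ} {x y : EuclideanSpace ℝ (Fin d)} (hx : x ∈ H.cube n k)
    (hy : y ∈ H.cube n k) (i : Fin d) : |x i - y i| ≤ 1 / 2 ^ n := by
  have h1 := hx i
  have h2 := hy i
  rw [add_div] at h1 h2
  rw [abs_le]
  constructor <;> linarith [h1.1, h1.2, h2.1, h2.2]

/-- The curve of a numbering: the limit of the lower corners of the cubes that have the same
numbers as the dyadic intervals around `t`. -/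
noncomputable def curve (t : ℝ) : EuclideanSpace ℝ (Fin d) :=
  WithLp.toLp 2 fun i => ⨆ n, (H.cell n (dyadicIndex d n t) i : ℝ) / 2 ^ n

theorem curve_mem_cube_dyadicIndex (n : ℕ) (t : ℝ) : H.curve t ∈ H.cube n (dyadicIndex d n t) := by
  intro i
  have hstep : ∀ m, H.cell (m + 1) (dyadicIndex d (m + 1) t) i / 2 =
      H.cell m (dyadicIndex d m t) i := fun m => by
    rw [H.cell_succ_div, dyadicIndex_succ_div]
  have hmono : Monotone fun m => (H.cell m (dyadicIndex d m t) i : ℝ) / 2 ^ m := by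
    refine monotone_nat_of_le_succ fun m => ?_
    have h : 2 * H.cell m (dyadicIndex d m t) i ≤ H.cell (m + 1) (dyadicIndex d (m + 1) t) i := by
      have := hstep m
      omega
    rw [pow_succ, div_le_div_iff₀ (by positivity) (by positivity)]
    have : (0 : ℝ) < 2 ^ m := by positivity
    have h' : 2 * (H.cell m (dyadicIndex d m t) i : ℝ) ≤
      H.cell (m + 1) (dyadicIndex d (m + 1) t) i := by exact_mod_cast h
    nlinarith
  have hanti : Antitone fun m => (1 + (H.cell m (dyadicIndex d m t) i : ℝ)) / 2 ^ m := by
    refine antitone_nat_of_succ_le fun m => ?_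
    have h : H.cell (m + 1) (dyadicIndex d (m + 1) t) i ≤
        2 * H.cell m (dyadicIndex d m t) i + 1 := by
      have := hstep m
      omega
    rw [pow_succ, div_le_div_iff₀ (by positivity) (by positivity)]
    have : (0 : ℝ) < 2 ^ m := by positivity
    have h' : (H.cell (m + 1) (dyadicIndex d (m + 1) t) i : ℝ) ≤
      2 * (H.cell m (dyadicIndex d m t) i : ℝ) + 1 := by exact_mod_cast h
    nlinarith
  have hle : ∀ m, (H.cell m (dyadicIndex d m t) i : ℝ) / 2 ^ m ≤
      (1 + (H.cell n (dyadicIndex d n t) i : ℝ)) / 2 ^ n := fun m =>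
    calc _ ≤ (H.cell (max m n) (dyadicIndex d (max m n) t) i : ℝ) / 2 ^ (max m n) :=
          hmono (le_max_left m n)
      _ ≤ (1 + (H.cell (max m n) (dyadicIndex d (max m n) t) i : ℝ)) / 2 ^ (max m n) := by
          gcongr
          linarith
      _ ≤ _ := hanti (le_max_right m n)
  constructor
  · exact le_ciSup (f := fun m => (H.cell m (dyadicIndex d m t) i : ℝ) / 2 ^ m)
      ⟨_, forall_mem_range.2 hle⟩ n
  · exact ciSup_le hle

theorem entry_mul_pow (n k j : ℕ) (i : Fin d) :
    H.entry (n + j) (k * 2 ^ (j * d)) i = 2 ^ j * H.entry n k i := by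
  induction j with
  | zero => simp
  | succ j ih =>
    rw [Nat.succ_mul, pow_add, ← mul_assoc, ← add_assoc, H.entry_succ_mul, ih, pow_succ]
    ring

/-- The lattice points at which the cubes are entered are the values of the curve at the endpoints
of the dyadic intervals. -/
theorem curve_div_eq_entry {n k : ℕ} (hk : k < 2 ^ (n * d)) (i : Fin d) :
    H.curve ((k : ℝ) / 2 ^ (n * d)) i = H.entry n k i / 2 ^ n := by
  refine eq_of_forall_abs_sub_le_div_two_pow (C := 1) fun j => ?_
  have hidx : dyadicIndex d (n + j) ((k : ℝ) / 2 ^ (n * d)) = k * 2 ^ (j * d) := by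
    have hkey : ((k * 2 ^ (j * d) : ℕ) : ℝ) / 2 ^ ((n + j) * d) = (k : ℝ) / 2 ^ (n * d) := by
      rw [add_mul, pow_add]
      push_cast
      field_simp
    apply dyadicIndex_eq
    · rw [add_mul, pow_add]
      exact Nat.mul_lt_mul_of_pos_right hk (by positivity)
    · rw [hkey]
    · rw [add_div, hkey]
      have : (0 : ℝ) < 1 / 2 ^ ((n + j) * d) := by positivity
      linarith
  have h1 := H.curve_mem_cube_dyadicIndex (n + j) ((k : ℝ) / 2 ^ (n * d)) i
  rw [hidx] at h1
  have h2 := H.entry_mem (n + j) (k * 2 ^ (j * d)) i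
  rw [entry_mul_pow] at h2
  set c := H.cell (n + j) (k * 2 ^ (j * d)) i
  have h3 : ((c : ℝ)) / 2 ^ (n + j) ≤ H.entry n k i / 2 ^ n := by
    have : (c : ℝ) ≤ 2 ^ j * H.entry n k i := by exact_mod_cast h2.1
    rw [pow_add, div_le_div_iff₀ (by positivity) (by positivity)]
    have : (0 : ℝ) < 2 ^ n := by positivity
    nlinarith
  have h4 : (H.entry n k i : ℝ) / 2 ^ n ≤ (1 + (c : ℝ)) / 2 ^ (n + j) := by
    have : 2 ^ j * (H.entry n k i : ℝ) ≤ c + 1 := by exact_mod_cast h2.2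
    rw [pow_add, div_le_div_iff₀ (by positivity) (by positivity)]
    have : (0 : ℝ) < 2 ^ n := by positivity
    nlinarith
  have h5 : (1 : ℝ) / 2 ^ (n + j) ≤ 1 / 2 ^ j := by
    gcongr
    · norm_num
    · omega
  have h6 := h1.1
  have h7 := h1.2
  rw [add_div] at h4 h7
  rw [abs_le]
  constructor <;> linarith

theorem curve_div_mem_cube {n k : ℕ} (hk : k < 2 ^ (n * d)) :
    H.curve ((k : ℝ) / 2 ^ (n * d)) ∈ H.cube n k := by
  intro i
  rw [H.curve_div_eq_entry hk]
  have := H.entry_mem n k i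
  constructor <;> gcongr
  · exact_mod_cast this.1
  · rw [add_comm]
    exact_mod_cast this.2

theorem curve_succ_div_mem_cube {n k : ℕ} (hk : k + 1 < 2 ^ (n * d)) :
    H.curve (((k + 1 : ℕ) : ℝ) / 2 ^ (n * d)) ∈ H.cube n k := by
  intro i
  rw [H.curve_div_eq_entry hk]
  have := H.entry_succ_mem n k hk i
  constructor <;> gcongr
  · exact_mod_cast this.1
  · rw [add_comm 1 (H.cell n k i : ℝ)]
    exact_mod_cast this.2

theorem curve_mem_cube {n k : ℕ} (hk : k < 2 ^ (n * d)) {t : ℝ}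
    (ht : t ∈ Icc ((k : ℝ) / 2 ^ (n * d)) ((1 + k) / 2 ^ (n * d))) : H.curve t ∈ H.cube n k := by
  rcases ht.2.eq_or_lt with h | h
  · by_cases hk1 : k + 1 < 2 ^ (n * d)
    · have := H.curve_succ_div_mem_cube hk1
      rwa [Nat.cast_add, Nat.cast_one, add_comm (k : ℝ), ← h] at this
    · have hk2 : 1 + k = 2 ^ (n * d) := by omega
      have ht1 : t = 1 := by
        rw [h, div_eq_one_iff_eq (by positivity)]
        exact_mod_cast hk2
      have := H.curve_mem_cube_dyadicIndex n t
      rwa [ht1, dyadicIndex_one, ← hk2, Nat.add_sub_cancel_left, ← ht1] at this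
  · have := H.curve_mem_cube_dyadicIndex n t
    rwa [dyadicIndex_eq hk ht.1 h] at this

theorem abs_curve_sub_le {n : ℕ} {s t : ℝ} (hs : s ∈ Icc (0 : ℝ) 1) (ht : t ∈ Icc (0 : ℝ) 1)
    (h : |s - t| ≤ 1 / 2 ^ (n * d)) (i : Fin d) : |H.curve s i - H.curve t i| ≤ 2 / 2 ^ n := by
  wlog hst : s ≤ t generalizing s t
  · rw [abs_sub_comm] at h ⊢
    exact this ht hs h (le_of_not_ge hst)
  have hpos : (0 : ℝ) < 2 ^ (n * d) := by positivity
  have hk := dyadicIndex_lt d n s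
  have hsk := mem_dyadicIndex d n hs
  set k := dyadicIndex d n s
  have hsc := H.curve_mem_cube hk hsk
  have h2 : (2 : ℝ) / 2 ^ n = 1 / 2 ^ n + 1 / 2 ^ n := by ring
  have h0 : (0 : ℝ) < 1 / 2 ^ n := by positivity
  rcases le_or_gt t ((1 + k) / 2 ^ (n * d)) with htk | htk
  · have := H.abs_sub_le_of_mem_cube hsc (H.curve_mem_cube hk ⟨hsk.1.trans hst, htk⟩) i
    linarith
  · -- the two intervals share an endpoint, whose image lies in both cubes
    have hk1 : k + 1 < 2 ^ (n * d) := by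
      have := htk.trans_le ht.2
      rw [div_lt_one hpos] at this
      have : ((k + 1 : ℕ) : ℝ) < ((2 ^ (n * d) : ℕ) : ℝ) := by
        push_cast
        linarith
      exact_mod_cast this
    have h3 : t ≤ (1 + ((k + 1 : ℕ) : ℝ)) / 2 ^ (n * d) := by
      have h4 := hsk.2
      have h5 := (abs_le.1 h).1
      have : (1 + ((k + 1 : ℕ) : ℝ)) / 2 ^ (n * d) =
        (1 + k) / 2 ^ (n * d) + 1 / 2 ^ (n * d) := by push_cast; ring
      linarith
    have htc := H.curve_mem_cube hk1 (t := t) ⟨by push_cast; rw [add_comm]; exact htk.le, h3⟩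
    have h6 := H.abs_sub_le_of_mem_cube hsc (H.curve_succ_div_mem_cube hk1) i
    have h7 := H.abs_sub_le_of_mem_cube (H.curve_div_mem_cube hk1) htc i
    calc _ ≤ _ := abs_sub_le _ (H.curve (((k + 1 : ℕ) : ℝ) / 2 ^ (n * d)) i) _
      _ ≤ _ := by linarith

/-- The curve as a map on the unit interval. -/
noncomputable def curveOn (t : Icc (0 : ℝ) 1) : EuclideanSpace ℝ (Fin d) := H.curve t

theorem holderWith_curveOn (hd : 1 ≤ d) :
    HolderWith (4 * d) (1 / d) H.curveOn := by
  intro s t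
  rcases eq_or_ne s t with rfl | hne
  · simp
  have hd0 : d ≠ 0 := by omega
  have hpos : 0 < dist s t := dist_pos.2 hne
  have hle : dist s t ≤ 1 := by
    rw [Subtype.dist_eq]
    exact Real.dist_le_of_mem_Icc_01 s.2 t.2
  set η := dist s t ^ (1 / (d : ℝ)) with hη
  have hηpos : 0 < η := Real.rpow_pos_of_pos hpos _
  have hη1 : η ≤ 1 := Real.rpow_le_one hpos.le hle (by positivity)
  have hηd : η ^ d = dist s t := by
    rw [hη, one_div, Real.rpow_inv_natCast_pow hpos.le hd0]
  obtain ⟨n, hn1, hn2⟩ := exists_nat_pow_near_of_lt_one hηpos hη1 (y := 1 / 2) (by norm_num)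
    (by norm_num)
  have hclose : |(s : ℝ) - t| ≤ 1 / 2 ^ (n * d) := by
    rw [← Real.dist_eq, ← Subtype.dist_eq, ← hηd, pow_mul]
    calc η ^ d ≤ ((1 / 2) ^ n) ^ d := pow_le_pow_left₀ hηpos.le hn2 d
      _ = 1 / (2 ^ n) ^ d := by simp
  have hdist : dist (H.curveOn s) (H.curveOn t) ≤ 4 * d * η :=
    calc _ ≤ (d : ℝ) * (2 / 2 ^ n) := EuclideanSpace.dist_le_of_forall_abs_sub_le (by positivity)
          (H.abs_curve_sub_le s.2 t.2 hclose)
      _ = 4 * d * (1 / 2) ^ (n + 1) := by rw [pow_succ, one_div_pow]; ring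
      _ ≤ 4 * d * η := by gcongr
  rw [edist_dist, edist_dist, ENNReal.ofReal_rpow_of_pos hpos]
  have : ((4 * d : NNReal) : ℝ≥0∞) = ENNReal.ofReal (4 * d) := by
    rw [ENNReal.ofReal_mul (by norm_num)]
    simp
  rw [this, ← ENNReal.ofReal_mul (by positivity)]
  refine ENNReal.ofReal_le_ofReal ?_
  simpa [hη] using hdist

theorem continuous_curveOn (hd : 1 ≤ d) : Continuous H.curveOn :=
  (H.holderWith_curveOn hd).continuous (by positivity)

/-- Each point of a cube lies in a descendant of the cube at every deeper level. -/
theorem exists_descendant {n k : ℕ} {x : EuclideanSpace ℝ (Fin d)} (hx : x ∈ H.cube n k) (j : ℕ) :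
    ∃ l, l / 2 ^ (j * d) = k ∧ x ∈ H.cube (n + j) l := by
  induction j with
  | zero => exact ⟨k, by simp, hx⟩
  | succ j ih =>
    obtain ⟨l, hl, hxl⟩ := ih
    obtain ⟨m, hm, hmu⟩ := H.exists_child (n + j) l fun i =>
      decide ((2 * (H.cell (n + j) l i : ℝ) + 1) / 2 ^ (n + j + 1) ≤ x i)
    refine ⟨m, ?_, fun i => ?_⟩
    · rw [Nat.succ_mul, add_comm, pow_add, ← Nat.div_div_eq_div_mul, hm, hl]
    · rw [← add_assoc, hmu i]
      have h1 := hxl i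
      have h2 : (0 : ℝ) < 2 ^ (n + j) := by positivity
      rw [mem_Icc, div_le_iff₀ h2, le_div_iff₀ h2] at h1
      by_cases h : (2 * (H.cell (n + j) l i : ℝ) + 1) / 2 ^ (n + j + 1) ≤ x i
      · simp only [h, decide_true, Bool.toNat_true]
        rw [mem_Icc, le_div_iff₀ (by positivity), pow_succ]
        push_cast
        refine ⟨by simpa [pow_succ] using h, by linarith⟩
      · simp only [h, decide_false, Bool.toNat_false]
        rw [not_le, lt_div_iff₀ (by positivity)] at h
        rw [mem_Icc, div_le_iff₀ (by positivity), le_div_iff₀ (by positivity)]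
        push_cast
        refine ⟨by rw [pow_succ]; linarith, by linarith⟩

theorem curveOn_image_interval (hd : 1 ≤ d) {n k : ℕ} (hk : k < 2 ^ (n * d)) :
    H.curveOn '' {t | (t : ℝ) ∈ Icc ((k : ℝ) / 2 ^ (n * d)) ((1 + (k : ℝ)) / 2 ^ (n * d))} =
      H.cube n k := by
  refine Subset.antisymm ?_ fun x hx => ?_
  · rintro _ ⟨t, ht, rfl⟩
    exact H.curve_mem_cube hk ht
  · -- the image is compact and comes arbitrarily close to `x`
    set A : Set (Icc (0 : ℝ) 1) :=
      {t | (t : ℝ) ∈ Icc ((k : ℝ) / 2 ^ (n * d)) ((1 + (k : ℝ)) / 2 ^ (n * d))}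
    have hA : IsClosed A := isClosed_Icc.preimage continuous_subtype_val
    have hclosed : IsClosed (H.curveOn '' A) :=
      (hA.isCompact.image (H.continuous_curveOn hd)).isClosed
    rw [← hclosed.closure_eq, Metric.mem_closure_iff]
    intro ε hε
    have hlim : Tendsto (fun j : ℕ => (d : ℝ) / 2 ^ j) atTop (𝓝 0) :=
      tendsto_const_nhds.div_atTop (tendsto_pow_atTop_atTop_of_one_lt one_lt_two)
    obtain ⟨j, hj⟩ := (hlim.eventually (gt_mem_nhds hε)).exists
    obtain ⟨l, hl, hxl⟩ := H.exists_descendant hx j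
    have hpow : 2 ^ ((n + j) * d) = 2 ^ (n * d) * 2 ^ (j * d) := by rw [add_mul, pow_add]
    have hpowR : (2 : ℝ) ^ ((n + j) * d) = 2 ^ (n * d) * 2 ^ (j * d) := by rw [add_mul, pow_add]
    have hJ : 0 < 2 ^ (j * d) := by positivity
    have hlt : l < 2 ^ ((n + j) * d) := by
      rw [hpow, ← Nat.div_lt_iff_lt_mul hJ, hl]
      exact hk
    have hl1 : (k : ℝ) * 2 ^ (j * d) ≤ l := by
      have := Nat.div_mul_le_self l (2 ^ (j * d))
      rw [hl] at this
      exact_mod_cast this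
    have hl2 : (l : ℝ) ≤ (1 + k) * 2 ^ (j * d) := by
      have := Nat.lt_div_mul_add hJ (a := l)
      rw [hl] at this
      have : l ≤ (1 + k) * 2 ^ (j * d) := by rw [add_mul]; omega
      exact_mod_cast this
    have hl3 : (l : ℝ) ≤ 2 ^ ((n + j) * d) := by exact_mod_cast hlt.le
    refine ⟨_, ⟨⟨(l : ℝ) / 2 ^ ((n + j) * d), by positivity, ?_⟩, ⟨?_, ?_⟩, rfl⟩, ?_⟩
    · rw [div_le_one (by positivity)]
      exact hl3
    · simp only
      rw [hpowR, div_le_div_iff₀ (by positivity) (by positivity)]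
      have : (0 : ℝ) < 2 ^ (n * d) := by positivity
      nlinarith
    · simp only
      rw [hpowR, div_le_div_iff₀ (by positivity) (by positivity)]
      have : (0 : ℝ) < 2 ^ (n * d) := by positivity
      nlinarith
    · refine lt_of_le_of_lt ?_ hj
      rw [← mul_one_div (d : ℝ)]
      refine EuclideanSpace.dist_le_of_forall_abs_sub_le (by positivity) fun i => ?_
      refine (H.abs_sub_le_of_mem_cube hxl (H.curve_div_mem_cube hlt) i).trans ?_
      gcongr
      · norm_num
      · omega

theorem curveOn_mem_unitCube (t : Icc (0 : ℝ) 1) : H.curveOn t ∈ unitCube d := fun i => by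
  simpa [H.cell_zero, curveOn] using H.curve_mem_cube_dyadicIndex 0 t i

theorem exists_curveOn_eq (hd : 1 ≤ d) {x : EuclideanSpace ℝ (Fin d)} (hx : x ∈ unitCube d) :
    ∃ t, H.curveOn t = x := by
  have : x ∈ H.cube 0 0 := fun i => by simpa [H.cell_zero] using hx i
  rw [← H.curveOn_image_interval hd (by simp)] at this
  obtain ⟨t, -, ht⟩ := this
  exact ⟨t, ht⟩

theorem image_intervalLevel (hd : 1 ≤ d) (n : ℕ) :
    (fun A => H.curveOn '' A) '' intervalLevel d n = cubeLevel d n := by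
  refine Subset.antisymm ?_ ?_
  · rintro _ ⟨A, ⟨k, hk, hA⟩, rfl⟩
    refine ⟨H.cell n k, H.cell_lt hk, ?_⟩
    have hA' : A = Subtype.val ⁻¹'
        Icc ((k : ℝ) / 2 ^ (n * d)) ((1 + (k : ℝ)) / 2 ^ (n * d)) := by
      rw [← preimage_image_eq A Subtype.val_injective, hA]
      rfl
    rw [hA']
    exact H.curveOn_image_interval hd hk
  · rintro _ ⟨c, hc, rfl⟩
    obtain ⟨k, hk, rfl⟩ := H.exists_cell_eq c hc
    refine ⟨_, ⟨k, hk, ?_⟩, H.curveOn_image_interval hd hk⟩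
    have hN : (0 : ℝ) < 2 ^ (n * d) := by positivity
    refine Subtype.image_preimage_coe _ _ |>.trans (inter_eq_right.2 fun t ht => ⟨?_, ?_⟩)
    · exact le_trans (by positivity) ht.1
    · refine ht.2.trans ((div_le_one hN).2 ?_)
      rw [add_comm]
      exact_mod_cast hk

end DyadicOrder

/-! ### Box dimension -/

section BoxDimension

/-- A set of lattice points is counted by covering it with boxes of `M^d` points, one for each element
of `S`. -/
theorem ncard_le_of_forall_exists_box {β : Type*} {d : ℕ} {S : Set β} (hS : S.Finite)
    (g : β → Fin d → ℤ) (M : ℕ) {S' : Set (Fin d → ℤ)}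
    (h : ∀ k' ∈ S', ∃ k ∈ S, ∀ i, g k i ≤ k' i ∧ k' i < g k i + M) :
    S'.Finite ∧ S'.ncard ≤ M ^ d * S.ncard := by
  classical
  set B : Finset (Fin d → ℤ) := hS.toFinset.biUnion fun k =>
    Fintype.piFinset fun i => Finset.Ico (g k i) (g k i + M) with hB
  have hsub : S' ⊆ B := fun k' hk' => by
    obtain ⟨k, hk, hkk⟩ := h k' hk'
    simp only [hB, Finset.coe_biUnion, mem_iUnion]
    exact ⟨k, by simpa using hk, by simpa [Fintype.mem_piFinset] using hkk⟩
  refine ⟨B.finite_toSet.subset hsub, ?_⟩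
  calc S'.ncard ≤ (B : Set (Fin d → ℤ)).ncard := ncard_le_ncard hsub B.finite_toSet
    _ = B.card := ncard_coe_finset B
    _ ≤ hS.toFinset.card * M ^ d := Finset.card_biUnion_le_card_mul _ _ _ fun k _ => by
        simp [Fintype.card_piFinset]
    _ = M ^ d * S.ncard := by rw [ncard_eq_toFinset_card S hS, mul_comm]

variable {d : ℕ}

theorem finite_gridCube_inter {F : Set (EuclideanSpace ℝ (Fin d))} (hF : F ⊆ unitCube d) {δ : ℝ}
    (hδ : 0 < δ) : {k : Fin d → ℤ | (gridCube δ k ∩ F).Nonempty}.Finite := by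
  refine (ncard_le_of_forall_exists_box (finite_singleton ()) (fun _ _ => -1) (⌊1 / δ⌋₊ + 2)
    fun k hk => ⟨(), rfl, fun i => ?_⟩).1
  obtain ⟨x, hxk, hxF⟩ := hk
  have h1 := hxk i
  have h2 := hF hxF i
  constructor
  · have : 0 ≤ (1 + (k i : ℝ)) := nonneg_of_mul_nonneg_left (h2.1.trans h1.2) hδ
    have : 0 ≤ 1 + k i := by exact_mod_cast this
    omega
  · have h3 : (k i : ℝ) ≤ 1 / δ := by
      rw [le_div_iff₀ hδ]
      exact h1.1.trans h2.2
    have h4 := Nat.lt_floor_add_one (1 / δ)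
    have : (k i : ℝ) < ((⌊1 / δ⌋₊ + 1 : ℕ) : ℝ) := by
      push_cast
      linarith
    have : k i < ((⌊1 / δ⌋₊ + 1 : ℕ) : ℤ) := by exact_mod_cast this
    push_cast at this ⊢
    linarith

/-- A change of scale by a bounded factor changes the number of boxes by a bounded factor. -/
theorem boxCount_le_of_le_mul {F : Set (EuclideanSpace ℝ (Fin d))} (hF : F ⊆ unitCube d)
    {δ δ' : ℝ} (hδ : 0 < δ) (hδ' : 0 < δ') {m : ℕ} (h : δ ≤ m * δ') :
    boxCount F δ' ≤ (m + 2) ^ d * boxCount F δ := by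
  refine (ncard_le_of_forall_exists_box (finite_gridCube_inter hF hδ)
    (fun k i => ⌈(k i : ℝ) * δ / δ'⌉ - 1) (m + 2) ?_).2
  rintro k' ⟨x, hxk, hxF⟩
  have hfl : ∀ i, (⌊x i / δ⌋ : ℝ) * δ ≤ x i ∧ x i ≤ (1 + (⌊x i / δ⌋ : ℝ)) * δ := fun i => by
    have h1 := Int.floor_le (x i / δ)
    have h2 := (Int.lt_floor_add_one (x i / δ)).le
    rw [le_div_iff₀ hδ] at h1
    rw [div_le_iff₀ hδ] at h2
    exact ⟨h1, by linarith⟩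
  refine ⟨fun i => ⌊x i / δ⌋, ⟨x, hfl, hxF⟩, fun i => ?_⟩
  obtain ⟨h1, h2⟩ := hfl i
  obtain ⟨h3, h4⟩ := hxk i
  set k := ⌊x i / δ⌋
  constructor
  · have : ⌈(k : ℝ) * δ / δ'⌉ ≤ 1 + k' i := by
      rw [Int.ceil_le, div_le_iff₀ hδ']
      push_cast
      exact h1.trans h4
    linarith
  · have h5 : (k' i : ℝ) ≤ k * δ / δ' + m := by
      have : (k : ℝ) * δ / δ' + m = (k * δ + m * δ') / δ' := by field_simp
      rw [this, le_div_iff₀ hδ']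
      linarith
    have h6 := Int.le_ceil ((k : ℝ) * δ / δ')
    have : (k' i : ℝ) ≤ ((⌈(k : ℝ) * δ / δ'⌉ + m : ℤ) : ℝ) := by
      push_cast
      linarith
    have : k' i ≤ ⌈(k : ℝ) * δ / δ'⌉ + m := by exact_mod_cast this
    push_cast
    linarith

theorem toLine_image_curvePreimage_subset (α : Icc (0 : ℝ) 1 → EuclideanSpace ℝ (Fin d))
    (F : Set (EuclideanSpace ℝ (Fin d))) : toLine '' curvePreimage α F ⊆ unitCube 1 := by
  rintro _ ⟨_, ⟨t, -, rfl⟩, rfl⟩ i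
  simp [toLine]

namespace DyadicOrder

variable (H : DyadicOrder d) {F : Set (EuclideanSpace ℝ (Fin d))}

/-- The factor `3^d` accounts for closed grid cubes that meet `F` only in a point of their boundary:
such a cube is a neighbour of the cube that belongs to a parameter of that point. -/
theorem boxCount_le_boxCount_preimage (hd : 1 ≤ d) (hF : F ⊆ unitCube d) (n : ℕ) :
    boxCount F (1 / 2 ^ n) ≤
      3 ^ d * boxCount (toLine '' curvePreimage H.curveOn F) (1 / 2 ^ (n * d)) := by
  refine (ncard_le_of_forall_exists_box
    (finite_gridCube_inter (toLine_image_curvePreimage_subset H.curveOn F) (by positivity))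
    (fun κ i => (H.cell n (κ 0).toNat i : ℤ) - 1) 3 ?_).2
  rintro k ⟨x, hxk, hxF⟩
  obtain ⟨t, rfl⟩ := H.exists_curveOn_eq hd (hF hxF)
  have ht := mem_dyadicIndex d n t.2
  refine ⟨fun _ => dyadicIndex d n t, ⟨toLine t, fun i => ?_, ⟨t, ⟨t, hxF, rfl⟩, rfl⟩⟩,
    fun i => ?_⟩
  · simpa [toLine, div_eq_mul_inv] using ht
  · have h1 := H.curve_mem_cube_dyadicIndex n t i
    have h2 := hxk i
    have hN : (0 : ℝ) < 2 ^ n := by positivity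
    simp only [curveOn, mul_one_div, mem_Icc, div_le_iff₀ hN, le_div_iff₀ hN] at h1 h2
    have h3 : (H.cell n (dyadicIndex d n t) i : ℝ) ≤ 1 + k i := by linarith
    have h4 : (k i : ℝ) ≤ 1 + H.cell n (dyadicIndex d n t) i := by linarith
    have h5 : (H.cell n (dyadicIndex d n t) i : ℤ) ≤ 1 + k i := by exact_mod_cast h3
    have h6 : k i ≤ 1 + (H.cell n (dyadicIndex d n t) i : ℤ) := by exact_mod_cast h4
    simp only [Int.toNat_natCast]
    push_cast
    constructor <;> linarith

theorem boxCount_preimage_le_boxCount (hF : F ⊆ unitCube d) (n : ℕ) :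
    boxCount (toLine '' curvePreimage H.curveOn F) (1 / 2 ^ (n * d)) ≤
      3 * boxCount F (1 / 2 ^ n) := by
  let c : ℕ → Fin d → ℤ := fun k i => H.cell n k i
  have hc : InjOn c (Iio (2 ^ (n * d))) := fun k hk l hl hkl =>
    H.cell_injOn n hk hl (funext fun i => by simpa [c] using congrFun hkl i)
  have key := (ncard_le_of_forall_exists_box (finite_gridCube_inter hF (δ := 1 / 2 ^ n)
    (by positivity)) (d := 1) (fun k _ => ((Function.invFunOn c (Iio (2 ^ (n * d))) k : ℕ) : ℤ) - 1) 3
    (S' := {k | (gridCube (1 / 2 ^ (n * d)) k ∩ toLine '' curvePreimage H.curveOn F).Nonempty})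
    ?_).2
  · simpa only [pow_one, boxCount] using key
  rintro κ ⟨_, hxk, ⟨_, ⟨t, htF, rfl⟩, rfl⟩⟩
  have hlt := dyadicIndex_lt d n t
  refine ⟨c (dyadicIndex d n t), ⟨H.curveOn t, fun i => ?_, htF⟩, fun i => ?_⟩
  · simpa [c, curveOn, div_eq_mul_inv] using H.curve_mem_cube_dyadicIndex n t i
  · rw [hc.leftInvOn_invFunOn hlt]
    have h1 := mem_dyadicIndex d n t.2
    have h2 := hxk i
    have hN : (0 : ℝ) < 2 ^ (n * d) := by positivity
    have h0 : (toLine (t : ℝ)) i = t := by simp [toLine]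
    rw [h0] at h2
    simp only [mul_one_div, mem_Icc, div_le_iff₀ hN, le_div_iff₀ hN] at h1 h2
    have h3 : (dyadicIndex d n t : ℝ) ≤ 1 + κ i := by linarith
    have h4 : (κ i : ℝ) ≤ 1 + dyadicIndex d n t := by linarith
    have h5 : (dyadicIndex d n t : ℤ) ≤ 1 + κ i := by exact_mod_cast h3
    have h6 : κ i ≤ 1 + (dyadicIndex d n t : ℤ) := by exact_mod_cast h4
    push_cast
    constructor <;> linarith

/-- Up to a constant factor, a set meets as many boxes of side `η` as its preimage under the curve
meets intervals of length `η^d`. -/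
theorem exists_boxCount_comparison (hd : 1 ≤ d) (hF : F ⊆ unitCube d) :
    ∃ C : ℕ, 1 ≤ C ∧ ∀ η : ℝ, 0 < η → η ≤ 1 →
      boxCount (toLine '' curvePreimage H.curveOn F) (η ^ d) ≤ C * boxCount F η ∧
      boxCount F η ≤ C * boxCount (toLine '' curvePreimage H.curveOn F) (η ^ d) := by
  set E := toLine '' curvePreimage H.curveOn F with hE
  have hEsub : E ⊆ unitCube 1 := toLine_image_curvePreimage_subset _ _
  set C₁ := (2 ^ d + 2) * (3 * 3 ^ d)
  set C₂ := 4 ^ d * (3 ^ d * 3)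
  refine ⟨max C₁ C₂, le_max_of_le_left (Nat.one_le_iff_ne_zero.2 (by positivity)),
    fun η hη hη1 => ?_⟩
  obtain ⟨n, hn1, hn2⟩ := exists_nat_pow_near_of_lt_one hη hη1 (y := 1 / 2) (by norm_num)
    (by norm_num)
  rw [one_div_pow] at hn1 hn2
  have hηd : 0 < η ^ d := by positivity
  have hn3 : 1 / 2 ^ n ≤ 2 * η := by
    have : (1 : ℝ) / 2 ^ n = 2 * (1 / 2 ^ (n + 1)) := by rw [pow_succ]; field_simp
    linarith
  have hpow : (1 : ℝ) / 2 ^ (n * d) = (1 / 2 ^ n) ^ d := by rw [one_div_pow, pow_mul]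
  have hpos : (0 : ℝ) < 1 / 2 ^ n := by positivity
  have hposd : (0 : ℝ) < 1 / 2 ^ (n * d) := by positivity
  have a1 : boxCount E (η ^ d) ≤ (2 ^ d + 2) ^ 1 * boxCount E (1 / 2 ^ (n * d)) := by
    refine boxCount_le_of_le_mul hEsub hposd hηd ?_
    rw [hpow]
    push_cast
    rw [← mul_pow]
    exact pow_le_pow_left₀ hpos.le hn3 d
  have a2 := H.boxCount_preimage_le_boxCount hF n
  have a3 : boxCount F (1 / 2 ^ n) ≤ (1 + 2) ^ d * boxCount F η :=
    boxCount_le_of_le_mul hF hη hpos (by simpa using hn2)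
  have b1 : boxCount F η ≤ (2 + 2) ^ d * boxCount F (1 / 2 ^ n) :=
    boxCount_le_of_le_mul hF hpos hη (by simpa using hn3)
  have b2 := H.boxCount_le_boxCount_preimage hd hF n
  have b3 : boxCount E (1 / 2 ^ (n * d)) ≤ (1 + 2) ^ 1 * boxCount E (η ^ d) := by
    refine boxCount_le_of_le_mul hEsub hηd hposd ?_
    rw [hpow, Nat.cast_one, one_mul]
    exact pow_le_pow_left₀ hη.le hn2 d
  rw [← hE] at a2 b2
  constructor
  · calc boxCount E (η ^ d) ≤ (2 ^ d + 2) * (3 * (3 ^ d * boxCount F η)) := by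
          rw [pow_one] at a1
          exact a1.trans (Nat.mul_le_mul_left _ (a2.trans (Nat.mul_le_mul_left _ a3)))
      _ = C₁ * boxCount F η := by ring
      _ ≤ _ := Nat.mul_le_mul_right _ (le_max_left _ _)
  · calc boxCount F η ≤ 4 ^ d * (3 ^ d * (3 * boxCount E (η ^ d))) := by
          rw [pow_one] at b3
          exact b1.trans (Nat.mul_le_mul_left _ (b2.trans (Nat.mul_le_mul_left _ b3)))
      _ = C₂ * boxCount E (η ^ d) := by ring
      _ ≤ _ := Nat.mul_le_mul_right _ (le_max_right _ _)

theorem hasBoxDim_preimage (hd : 1 ≤ d) (hF : F ⊆ unitCube d) {s : ℝ} (hs : HasBoxDim F s) :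
    HasBoxDim (toLine '' curvePreimage H.curveOn F) (s / d) := by
  obtain ⟨C, hC1, hC⟩ := H.exists_boxCount_comparison hd hF
  set E := toLine '' curvePreimage H.curveOn F
  have hd0 : d ≠ 0 := by omega
  have hdpos : (0 : ℝ) < d := by positivity
  have hCpos : (0 : ℝ) < C := by exact_mod_cast hC1
  have hlogC : 0 ≤ Real.log C := Real.log_nonneg (by exact_mod_cast hC1)
  have hlog : ∀ {a b : ℕ}, a ≤ C * b → b ≤ C * a → Real.log a ≤ Real.log C + Real.log b := by
    intro a b hab hba
    rcases Nat.eq_zero_or_pos a with rfl | ha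
    · have : b = 0 := by simpa using hba
      simpa [this] using hlogC
    · have hb : 0 < b := Nat.pos_of_ne_zero fun h => by simp [h] at hab; omega
      rw [← Real.log_mul hCpos.ne' (by positivity)]
      exact Real.log_le_log (by exact_mod_cast ha) (by exact_mod_cast hab)
  have hsmall : ∀ᶠ η : ℝ in 𝓝[>] 0, 0 < η ∧ η < 1 := Ioo_mem_nhdsGT one_pos
  have herr : Tendsto (fun η : ℝ => Real.log (boxCount E (η ^ d)) / -Real.log (η ^ d) -
      Real.log (boxCount F η) / -Real.log η / d) (𝓝[>] 0) (𝓝 0) := by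
    have hbound : Tendsto (fun η : ℝ => Real.log C / d / -Real.log η) (𝓝[>] 0) (𝓝 0) :=
      tendsto_const_nhds.div_atTop (tendsto_neg_atBot_atTop.comp Real.tendsto_log_nhdsGT_zero)
    refine squeeze_zero_norm' ?_ hbound
    filter_upwards [hsmall] with η hη
    have hl : 0 < -Real.log η := neg_pos.2 (Real.log_neg hη.1 hη.2)
    obtain ⟨h1, h2⟩ := hC η hη.1 hη.2.le
    have h3 := hlog h1 h2
    have h4 := hlog h2 h1
    rw [Real.log_pow, Real.norm_eq_abs]
    have : Real.log (boxCount E (η ^ d)) / -(d * Real.log η) -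
        Real.log (boxCount F η) / -Real.log η / d =
        (Real.log (boxCount E (η ^ d)) - Real.log (boxCount F η)) / (d * -Real.log η) := by
      have : Real.log η ≠ 0 := by linarith
      field_simp
      ring
    rw [this, abs_div, abs_of_pos (mul_pos hdpos hl), div_div]
    gcongr
    rw [abs_le]
    constructor <;> linarith
  have hη : Tendsto (fun η : ℝ => Real.log (boxCount E (η ^ d)) / -Real.log (η ^ d)) (𝓝[>] 0)
      (𝓝 (s / d)) := by
    simpa using herr.add (Tendsto.div_const hs (d : ℝ))
  -- substitute `η = δ^(1/d)`
  have hroot : Tendsto (fun δ : ℝ => δ ^ (1 / (d : ℝ))) (𝓝[>] 0) (𝓝[>] 0) := by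
    refine tendsto_nhdsWithin_iff.2 ⟨?_, ?_⟩
    · have := (Real.continuousAt_rpow_const 0 (1 / (d : ℝ)) (Or.inr (by positivity))).tendsto
      rw [Real.zero_rpow (by positivity)] at this
      exact this.mono_left nhdsWithin_le_nhds
    · filter_upwards [self_mem_nhdsWithin] with δ hδ
      exact Real.rpow_pos_of_pos hδ _
  refine (hη.comp hroot).congr' ?_
  filter_upwards [self_mem_nhdsWithin] with δ hδ
  have : (δ ^ (1 / (d : ℝ))) ^ d = δ := by
    rw [one_div, Real.rpow_inv_natCast_pow (le_of_lt hδ) hd0]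
  simp only [Function.comp_apply, this]

end DyadicOrder

end BoxDimension

/-! ### Hausdorff dimension -/

section HausdorffDimension

open MeasureTheory Measure Metric

/-- A number `D ≤ 2^{-m}` is at most some `2^{-n}`, `n ≥ m`, whose `s`-th power exceeds that of `D`
by no more than a factor `2^s` and an error `ε`; the error is needed for `D = 0` only. -/
theorem exists_two_inv_pow_near {D ε : ℝ≥0∞} {s : ℝ} (hs : 0 < s) (hε : ε ≠ 0) {m : ℕ}
    (hD : D ≤ 2⁻¹ ^ m) :
    ∃ n ≥ m, D ≤ 2⁻¹ ^ n ∧ ((2⁻¹ : ℝ≥0∞) ^ n) ^ s ≤ 2 ^ s * D ^ s + ε := by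
  have hhalf : (2⁻¹ : ℝ≥0∞) < 1 := by simp
  rcases eq_or_ne D 0 with rfl | hD0
  · have hlim : Tendsto (fun n : ℕ => ((2⁻¹ : ℝ≥0∞) ^ n) ^ s) atTop (𝓝 0) := by
      have := (ENNReal.continuous_rpow_const (y := s)).tendsto 0 |>.comp
        (ENNReal.tendsto_pow_atTop_nhds_zero_of_lt_one hhalf)
      rwa [ENNReal.zero_rpow_of_pos hs] at this
    obtain ⟨n, hn, hnm⟩ :=
      ((hlim.eventually (gt_mem_nhds (pos_iff_ne_zero.2 hε))).and (eventually_ge_atTop m)).exists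
    exact ⟨n, hnm, zero_le, hn.le.trans le_add_self⟩
  · have hex : ∃ n : ℕ, (2⁻¹ : ℝ≥0∞) ^ (n + 1) < D :=
      (((ENNReal.tendsto_pow_atTop_nhds_zero_of_lt_one hhalf).comp
        (tendsto_add_atTop_nat 1)).eventually (gt_mem_nhds (pos_iff_ne_zero.2 hD0))).exists
    classical
    set n := Nat.find hex
    have hn : (2⁻¹ : ℝ≥0∞) ^ (n + 1) < D := Nat.find_spec hex
    have hnm : m ≤ n := by
      by_contra! hlt
      exact absurd (hD.trans (pow_le_pow_right_of_le_one' hhalf.le (by omega : n + 1 ≤ m)))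
        (not_le.2 hn)
    refine ⟨n, hnm, ?_, ?_⟩
    · rcases Nat.eq_zero_or_pos n with h0 | h0
      · rw [h0, pow_zero]
        exact hD.trans (pow_le_one' hhalf.le m)
      · have := Nat.find_min hex (Nat.sub_lt h0 one_pos)
        rw [not_lt] at this
        rwa [show n - 1 + 1 = n by omega] at this
    · refine le_trans ?_ le_self_add
      rw [← ENNReal.mul_rpow_of_nonneg _ _ hs.le]
      refine ENNReal.rpow_le_rpow ?_ hs.le
      calc (2⁻¹ : ℝ≥0∞) ^ n = 2 * 2⁻¹ ^ (n + 1) := by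
            rw [pow_succ', ← mul_assoc, ENNReal.mul_inv_cancel two_ne_zero ENNReal.ofNat_ne_top,
              one_mul]
        _ ≤ 2 * D := by gcongr

/-- If the preimage of every set of diameter at most `2^{-n}` can be covered by a fixed number of
sets of diameter at most `2^{-nd}`, then the dimension of a set is at least `d` times that of its
preimage. -/
theorem mul_dimH_preimage_le {X Y ι : Type*} [EMetricSpace X] [EMetricSpace Y] [Fintype ι]
    {f : X → Y} {d : ℕ} (hd : 1 ≤ d)
    (h : ∀ (n : ℕ) (U : Set Y), ediam U ≤ 2⁻¹ ^ n →
      ∃ V : ι → Set X, (∀ a, ediam (V a) ≤ 2⁻¹ ^ (n * d)) ∧ f ⁻¹' U ⊆ ⋃ a, V a)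
    (F : Set Y) : (d : ℝ≥0∞) * dimH (f ⁻¹' F) ≤ dimH F := by
  borelize X Y
  have hdpos : 0 < d := hd
  refine le_of_forall_gt_imp_ge_of_dense fun b hb => ?_
  obtain ⟨s, hs, hsb⟩ := ENNReal.lt_iff_exists_nnreal_btwn.1 hb
  refine le_trans ?_ hsb.le
  have hspos : 0 < (s : ℝ) := by
    have : (0 : ℝ≥0∞) < s := zero_le.trans_lt hs
    exact_mod_cast this
  have hsd : 0 < (s : ℝ) / d := by positivity
  have hF : μH[(s : ℝ)] F = 0 := hausdorffMeasure_of_dimH_lt hs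
  -- coverings of `F` by small sets pull back to coverings of the preimage
  have hcover : ∀ m : ℕ, ∃ W : ℕ × ι → Set X, (∀ p, ediam (W p) ≤ 2⁻¹ ^ m) ∧
      f ⁻¹' F ⊆ ⋃ p, W p ∧
      ∑' p, ediam (W p) ^ ((s : ℝ) / d) ≤ Fintype.card ι * (2 ^ (s : ℝ) * 1 + 1) := by
    intro m
    obtain ⟨t, hFt, htm, hsum⟩ : ∃ t : ℕ → Set Y, F ⊆ ⋃ n, t n ∧ (∀ n, ediam (t n) ≤ 2⁻¹ ^ m) ∧
        ∑' n, ⨆ _ : (t n).Nonempty, ediam (t n) ^ (s : ℝ) < 1 := by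
      rw [hausdorffMeasure_apply] at hF
      have h0 := (ENNReal.iSup_eq_zero.1 (ENNReal.iSup_eq_zero.1 hF (2⁻¹ ^ m))
        (ENNReal.pow_pos (by simp) m)).trans_lt (zero_lt_one (α := ℝ≥0∞))
      simpa only [iInf_lt_iff, exists_prop] using h0
    obtain ⟨ε, hε, hεsum⟩ := ENNReal.exists_pos_sum_of_countable' one_ne_zero ℕ
    have hone : ∀ n, ∃ V : ι → Set X, (∀ a, ediam (V a) ≤ 2⁻¹ ^ m) ∧ f ⁻¹' t n ⊆ ⋃ a, V a ∧
        ∀ a, ediam (V a) ^ ((s : ℝ) / d) ≤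
          2 ^ (s : ℝ) * (⨆ _ : (t n).Nonempty, ediam (t n) ^ (s : ℝ)) + ε n := by
      intro n
      rcases (t n).eq_empty_or_nonempty with hn | hn
      · exact ⟨fun _ => ∅, by simp, by simp [hn], by simp [ENNReal.zero_rpow_of_pos hsd]⟩
      obtain ⟨l, hlm, hl, hls⟩ := exists_two_inv_pow_near hspos (hε n).ne' (htm n)
      obtain ⟨V, hV, hVt⟩ := h l (t n) hl
      have hhalf : (2⁻¹ : ℝ≥0∞) ≤ 1 := by simp
      refine ⟨V, fun a => (hV a).trans (pow_le_pow_right_of_le_one' hhalf ?_), hVt, fun a => ?_⟩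
      · exact hlm.trans (Nat.le_mul_of_pos_right l hdpos)
      · rw [iSup_pos hn]
        refine le_trans ?_ hls
        calc ediam (V a) ^ ((s : ℝ) / d) ≤ ((2⁻¹ : ℝ≥0∞) ^ (l * d)) ^ ((s : ℝ) / d) :=
              ENNReal.rpow_le_rpow (hV a) hsd.le
          _ = ((2⁻¹ : ℝ≥0∞) ^ l) ^ (s : ℝ) := by
              rw [pow_mul, ← ENNReal.rpow_natCast _ d, ← ENNReal.rpow_mul]
              congr 1
              field_simp
    choose V hVm hVt hVs using hone
    refine ⟨fun p => V p.1 p.2, fun p => hVm p.1 p.2, fun x hx => ?_, ?_⟩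
    · obtain ⟨n, hn⟩ := mem_iUnion.1 (hFt hx)
      obtain ⟨a, ha⟩ := mem_iUnion.1 (hVt n hn)
      exact mem_iUnion.2 ⟨(n, a), ha⟩
    · rw [ENNReal.tsum_prod (f := fun n a => ediam (V n a) ^ ((s : ℝ) / d))]
      calc ∑' n, ∑' a, ediam (V n a) ^ ((s : ℝ) / d)
          ≤ ∑' n, Fintype.card ι *
            (2 ^ (s : ℝ) * (⨆ _ : (t n).Nonempty, ediam (t n) ^ (s : ℝ)) + ε n) := by
            refine ENNReal.tsum_le_tsum fun n => ?_
            rw [tsum_fintype]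
            refine (Finset.sum_le_sum fun a _ => hVs n a).trans (le_of_eq ?_)
            rw [Finset.sum_const, Finset.card_univ, nsmul_eq_mul]
        _ = Fintype.card ι * (2 ^ (s : ℝ) *
            (∑' n, ⨆ _ : (t n).Nonempty, ediam (t n) ^ (s : ℝ)) + ∑' n, ε n) := by
            rw [ENNReal.tsum_mul_left, ENNReal.tsum_add, ENNReal.tsum_mul_left]
        _ ≤ _ := by gcongr
  choose W hWm hWF hWs using hcover
  have hfin : μH[((s / d : NNReal) : ℝ)] (f ⁻¹' F) ≠ ∞ := by
    have hle : μH[(s : ℝ) / d] (f ⁻¹' F) ≤ Fintype.card ι * (2 ^ (s : ℝ) * 1 + 1) :=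
      (hausdorffMeasure_le_liminf_tsum _ _ (l := atTop) (fun m : ℕ => 2⁻¹ ^ m)
        (ENNReal.tendsto_pow_atTop_nhds_zero_of_lt_one (by simp)) W
        (Eventually.of_forall hWm) (Eventually.of_forall hWF)).trans
        (liminf_le_of_le (by isBoundedDefault) fun b hb => by
          obtain ⟨m, hm⟩ := hb.exists
          exact hm.trans (hWs m))
    rw [NNReal.coe_div, NNReal.coe_natCast]
    refine (hle.trans_lt ?_).ne
    finiteness
  calc (d : ℝ≥0∞) * dimH (f ⁻¹' F) ≤ d * ((s / d : NNReal) : ℝ≥0∞) := by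
        gcongr
        exact dimH_le_of_hausdorffMeasure_ne_top hfin
    _ = ((d * (s / d) : NNReal) : ℝ≥0∞) := by push_cast; rfl
    _ = s := by
        congr 1
        field_simp

/-- The sets of the covering are indexed by the position, in each coordinate, of a dyadic cube
relative to the cubes around a fixed point of `U`; since different cubes have different numbers, each
of them is contained in one dyadic interval. -/
theorem DyadicOrder.exists_cover_preimage {d : ℕ} (H : DyadicOrder d) (n : ℕ)
    (U : Set (EuclideanSpace ℝ (Fin d))) (hU : ediam U ≤ 2⁻¹ ^ n) :
    ∃ V : (Fin d → Fin 4) → Set (Icc (0 : ℝ) 1),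
      (∀ a, ediam (V a) ≤ 2⁻¹ ^ (n * d)) ∧ H.curveOn ⁻¹' U ⊆ ⋃ a, V a := by
  have hhalf : ∀ m : ℕ, (2⁻¹ : ℝ≥0∞) ^ m = ENNReal.ofReal (1 / 2 ^ m) := fun m => by
    rw [← one_div_pow, ENNReal.ofReal_pow (by norm_num), one_div, ENNReal.ofReal_inv_of_pos two_pos]
    simp
  rcases U.eq_empty_or_nonempty with rfl | ⟨u, hu⟩
  · exact ⟨fun _ => ∅, by simp, by simp⟩
  -- a closed cube `[c, c+1]` that comes within distance `1` of `v` has `⌊v⌋ - 2 ≤ c ≤ ⌊v⌋ + 1`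
  refine ⟨fun o => {t | ∀ i, (H.cell n (dyadicIndex d n t) i : ℤ) =
    ⌊u i * 2 ^ n⌋ - 2 + (o i : ℕ)}, fun o => ediam_le fun s hs t ht => ?_, fun t ht => ?_⟩
  · have hidx : dyadicIndex d n s = dyadicIndex d n t :=
      H.cell_injOn n (dyadicIndex_lt d n s) (dyadicIndex_lt d n t) (funext fun i => by
        have := (hs i).trans (ht i).symm
        exact_mod_cast this)
    have h1 := mem_dyadicIndex d n s.2
    have h2 := mem_dyadicIndex d n t.2
    rw [hidx] at h1
    rw [hhalf, edist_dist]
    refine ENNReal.ofReal_le_ofReal ?_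
    rw [Subtype.dist_eq]
    refine (Real.dist_le_of_mem_Icc h1 h2).trans (le_of_eq ?_)
    ring
  · have hdist : dist (H.curveOn t) u ≤ 1 / 2 ^ n := by
      have := (edist_le_ediam_of_mem (mem_preimage.1 ht) hu).trans hU
      rwa [hhalf, edist_dist, ENNReal.ofReal_le_ofReal_iff (by positivity)] at this
    have hmem : ∀ i, ∃ o : Fin 4, (H.cell n (dyadicIndex d n t) i : ℤ) =
        ⌊u i * 2 ^ n⌋ - 2 + (o : ℕ) := fun i => by
      have h1 := H.curve_mem_cube_dyadicIndex n t i
      have h2 : |H.curveOn t i - u i| ≤ 1 / 2 ^ n := by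
        have := PiLp.norm_apply_le (H.curveOn t - u) i
        rw [← dist_eq_norm] at this
        exact this.trans hdist
      have hN : (0 : ℝ) < 2 ^ n := by positivity
      rw [abs_le] at h2
      simp only [curveOn] at h2
      rw [mem_Icc, div_le_iff₀ hN, le_div_iff₀ hN] at h1
      have h3 : (1 : ℝ) / 2 ^ n * 2 ^ n = 1 := by field_simp
      have h4 := mul_le_mul_of_nonneg_right h2.1 hN.le
      have h5 := mul_le_mul_of_nonneg_right h2.2 hN.le
      rw [neg_mul, h3, sub_mul] at h4
      rw [h3, sub_mul] at h5
      have h6 := Int.floor_le (u i * 2 ^ n)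
      have h7 := Int.lt_floor_add_one (u i * 2 ^ n)
      set c := H.cell n (dyadicIndex d n t) i
      have h8 : (c : ℝ) < ⌊u i * 2 ^ n⌋ + 2 := by linarith
      have h9 : (⌊u i * 2 ^ n⌋ : ℝ) ≤ c + 2 := by linarith
      have h10 : (c : ℤ) < ⌊u i * 2 ^ n⌋ + 2 := by exact_mod_cast h8
      have h11 : ⌊u i * 2 ^ n⌋ ≤ (c : ℤ) + 2 := by exact_mod_cast h9
      refine ⟨⟨((c : ℤ) - (⌊u i * 2 ^ n⌋ - 2)).toNat, by omega⟩, ?_⟩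
      simp only
      omega
    choose o ho using hmem
    exact mem_iUnion.2 ⟨o, ho⟩

theorem DyadicOrder.dimH_eq_mul_dimH_preimage {d : ℕ} (H : DyadicOrder d) (hd : 1 ≤ d)
    {F : Set (EuclideanSpace ℝ (Fin d))} (hF : F ⊆ unitCube d) :
    dimH F = (d : ℝ≥0∞) * dimH (curvePreimage H.curveOn F) := by
  have hd0 : (d : NNReal) ≠ 0 := by simpa using (by omega : d ≠ 0)
  have hval : dimH (curvePreimage H.curveOn F) = dimH (H.curveOn ⁻¹' F) :=
    isometry_subtype_coe.dimH_image _
  rw [hval]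
  refine le_antisymm ?_ (mul_dimH_preimage_le hd H.exists_cover_preimage F)
  have himage : H.curveOn '' (H.curveOn ⁻¹' F) = F :=
    image_preimage_eq_of_subset fun x hx => H.exists_curveOn_eq hd (hF hx)
  have hle := (H.holderWith_curveOn hd).dimH_image_le (by positivity) (H.curveOn ⁻¹' F)
  rw [himage] at hle
  refine hle.trans (le_of_eq ?_)
  rw [one_div, ENNReal.coe_inv hd0, div_eq_mul_inv, inv_inv, mul_comm, ENNReal.coe_natCast]

end HausdorffDimension

theorem mainTheorem1 (d : ℕ) (hd : 1 ≤ d) :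
    ∃ α : Icc (0 : ℝ) 1 → EuclideanSpace ℝ (Fin d),
      Continuous α ∧ (∀ t, α t ∈ unitCube d) ∧
      -- for every `n`, the images of the intervals of level `n` are exactly the cubes of level `n`
      (∀ n : ℕ, (fun A => α '' A) '' intervalLevel d n = cubeLevel d n) ∧
      ∀ F : Set (EuclideanSpace ℝ (Fin d)), F ⊆ unitCube d →
        (∀ s : ℝ, HasBoxDim F s →
          ∃ s' : ℝ, HasBoxDim (toLine '' curvePreimage α F) s' ∧ s = d * s') ∧
        dimH F = (d : ℝ≥0∞) * dimH (curvePreimage α F) := by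
  obtain ⟨H⟩ := exists_dyadicOrder d hd
  have hd0 : (d : ℝ) ≠ 0 := by simpa using (by omega : d ≠ 0)
  exact ⟨H.curveOn, H.continuous_curveOn hd, H.curveOn_mem_unitCube, H.image_intervalLevel hd,
    fun F hF => ⟨fun s hs => ⟨s / d, H.hasBoxDim_preimage hd hF hs, by field_simp⟩,
      H.dimH_eq_mul_dimH_preimage hd hF⟩⟩
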